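/- Let $\{\mathcal K_n\}_{n\ge 1}$ and $\{\mathcal H_n\}_{n\ge 1}$ be sequences of finite-dimensional complex Hilbert spaces, $\mathcal K_n\neq\{0\}$, and let $\Lambda=\{\Lambda_n\}_{n\ge1}$ be an arbitrary sequence of quantum channels, i.e. completely positive trace-preserving maps $\Lambda_n:\mathcal B(\mathcal K_n)\to\mathcal B(\mathcal H_n)$. A code of size $M\ge 1$ for $\Lambda_n$ consists of states (density operators) $\rho^1,\dots,\rho^{M}$ on $\mathcal K_n$ and positive operators $E^1,\dots,E^{M}$ on $\mathcal H_n$ with $\sum_i E^i\le I$; its average error probability is $\frac1{M}\sum_{i=1}^{M}\bigl(1-\mathrm{Tr}(\Lambda_n(\rho^i)E^i)\bigr)$. A real number $R$ is an achievable rate if there is a sequence of codes $\mathcal C^{(n)}$ for $\Lambda_n$, of sizes $M_n$ with $M_n\ge e^{nR}$ for all sufficiently large $n$, whose average error probabilities tend to $0$ as $n\to\infty$. The classical capacity $C(\Lambda)\in[0,+\infty]$ is the supremum of all achievable rates. For self-adjoint $X$ let $\{X\ge 0\}$ denote the projection onto the span of the eigenvectors of $X$ with nonnegative eigenvalues. For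 a sequence $\sigma=\{\sigma_n\}$ of states on bipartite spaces $\mathcal A_n\otimes\mathcal H_n$, with reduced states $\sigma_n^{A}$ and $\sigma_n^{H}$, the inf-spectral mutual information rate is $$\underline S(\sigma)=\sup\Bigl\{\gamma\in\mathbb R:\ \liminf_{n\to\infty}\mathrm{Tr}\bigl[\{\Pi_n(\gamma)\ge0\}\,\Pi_n(\gamma)\bigr]=1\Bigr\}\in[0,+\infty],\qquad \Pi_n(\gamma)=\sigma_n-e^{n\gamma}\,\sigma_n^{A}\otimes\sigma_n^{H}.$$ Theorem. The classical capacity is $$C(\Lambda)=\max_{\rho}\ \underline S\bigl(\{(\mathrm{id}_{\mathcal A_n}\otimes\Lambda_n)(\rho_n)\}_{n\ge1}\bigr),$$ where the maximum is over all sequences of finite-dimensional Hilbert spaces $\mathcal A_n$ and all sequences $\rho=\{\rho_n\}_{n\ge1}$ of separable states on $\mathcal A_n\otimes\mathcal K_n$ (a separable state is a finite convex combination $\sum_x p_x\,\sigma_x\otimes\tau_x$ of products of states), and the maximum is attained. -/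

import Mathlib

open Filter Topology
open scoped Kronecker ComplexOrder

noncomputable section

/-! Finite-dimensional Hilbert spaces are given by orthonormal bases indexed by finite types, so
`ℬ(ℋ)` is the algebra of complex matrices over the index type, and the index type of a tensor
product is the product of the index types. -/

namespace QInfoSpectrum

/-- A state (density operator): a positive operator of unit trace. -/
def IsState {ι : Type*} [Fintype ι] (ρ : Matrix ι ι ℂ) : Prop :=
  ρ.PosSemidef ∧ ρ.trace = 1

section Channel

open scoped MatrixOrder Matrix.Norms.L2Operator

/-- A quantum channel: a completely positive trace-preserving map `ℬ(𝒦) → ℬ(ℋ)`. -/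
structure Channel (κ η : Type*) [Fintype κ] [DecidableEq κ] [Fintype η] [DecidableEq η] extends
    CompletelyPositiveMap (Matrix κ κ ℂ) (Matrix η η ℂ) where
  /-- The map preserves the trace. -/
  trace_map : ∀ X : Matrix κ κ ℂ, (toLinearMap X).trace = X.trace

/-- The linear map `ℬ(𝒦) → ℬ(ℋ)` underlying a quantum channel. -/
def Channel.lin {κ η : Type*} [Fintype κ] [DecidableEq κ] [Fintype η] [DecidableEq η]
    (Λ : Channel κ η) : Matrix κ κ ℂ →ₗ[ℂ] Matrix η η ℂ :=
  Λ.toLinearMap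

end Channel

/-- The action `(id_A ⊗ Φ)(X)` of a linear map `Φ : ℬ(𝒦) → ℬ(ℋ)` on the second factor of
`X ∈ ℬ(ℋ_A ⊗ 𝒦)`: `Φ` is applied to each of the `A`-blocks of `X`. -/
def idTensor (α : Type*) {κ η : Type*} (Φ : Matrix κ κ ℂ →ₗ[ℂ] Matrix η η ℂ)
    (X : Matrix (α × κ) (α × κ) ℂ) : Matrix (α × η) (α × η) ℂ :=
  Matrix.of fun i j => Φ (Matrix.of fun q q' => X (i.1, q) (j.1, q')) i.2 j.2

/-- The reduced operator on the first factor (partial trace over the second factor). -/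
def reducedLeft {α β : Type*} [Fintype β] (X : Matrix (α × β) (α × β) ℂ) : Matrix α α ℂ :=
  Matrix.of fun a a' => ∑ b, X (a, b) (a', b)

/-- The reduced operator on the second factor (partial trace over the first factor). -/
def reducedRight {α β : Type*} [Fintype α] (X : Matrix (α × β) (α × β) ℂ) : Matrix β β ℂ :=
  Matrix.of fun b b' => ∑ a, X (a, b) (a, b')

/-- A separable state: a finite convex combination of products of states. -/
def IsSeparable {α β : Type*} [Fintype α] [Fintype β] (ρ : Matrix (α × β) (α × β) ℂ) : Prop :=
  ∃ (k : ℕ) (p : Fin k → ℝ) (σ : Fin k → Matrix α α ℂ) (τ : Fin k → Matrix β β ℂ),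
    (∀ x, 0 ≤ p x) ∧ ∑ x, p x = 1 ∧ (∀ x, IsState (σ x)) ∧ (∀ x, IsState (τ x)) ∧
      ρ = ∑ x, (p x : ℂ) • (σ x ⊗ₖ τ x)

/-- The spectral projection `{A ≥ 0}` of a self-adjoint operator `A`. -/
def nonnegProj {ι : Type*} [Fintype ι] [DecidableEq ι] (A : Matrix ι ι ℂ) : Matrix ι ι ℂ :=
  cfc (Set.indicator (Set.Ici (0 : ℝ)) (fun _ => (1 : ℝ))) A

/-- The difference operator `Π_n(γ) = ρ_n - e^{nγ} ω_n`. -/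
def diffOp {ι : Type*} (n : ℕ) (γ : ℝ) (ρ ω : Matrix ι ι ℂ) : Matrix ι ι ℂ :=
  ρ - (Real.exp (n * γ) : ℂ) • ω

/-- The number `Tr[{Π_n(γ) ≥ 0} Π_n(γ)]`. -/
def diffTrace {ι : Type*} [Fintype ι] [DecidableEq ι] (n : ℕ) (γ : ℝ) (ρ ω : Matrix ι ι ℂ) : ℝ :=
  (nonnegProj (diffOp n γ ρ ω) * diffOp n γ ρ ω).trace.re

/-- The quantum spectral inf-divergence rate
`sup {γ : liminf_{n → ∞} Tr[{Π_n(γ) ≥ 0} Π_n(γ)] = 1}`, as an extended real number. -/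
def infDivergenceRate {ι : ℕ → Type*} [∀ n, Fintype (ι n)] [∀ n, DecidableEq (ι n)]
    (ρ ω : ∀ n, Matrix (ι n) (ι n) ℂ) : EReal :=
  sSup {x : EReal | ∃ γ : ℝ, x = (γ : EReal) ∧
    liminf (fun n => (diffTrace n γ (ρ n) (ω n) : EReal)) atTop = 1}

/-- The inf-spectral mutual information rate of a sequence of bipartite states: the inf-divergence
rate of the sequence relative to the products of its reduced states. -/
def infMutualInfoRate {α β : ℕ → Type*} [∀ n, Fintype (α n)] [∀ n, DecidableEq (α n)]
    [∀ n, Fintype (β n)] [∀ n, DecidableEq (β n)]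
    (ρ : ∀ n, Matrix (α n × β n) (α n × β n) ℂ) : EReal :=
  infDivergenceRate ρ (fun n => reducedLeft (ρ n) ⊗ₖ reducedRight (ρ n))

/-- A code for classical messages over a channel with input space `κ` and output space `η`:
`size` many codewords, which are states of the input space, and as many positive operators on the
output space with sum at most the identity (the remaining outcome is a failure). -/
structure Code (κ η : Type*) [Fintype κ] [Fintype η] [DecidableEq η] where
  /-- The number of messages. -/
  size : ℕ
  size_pos : 0 < size
  /-- The codewords. -/
  codeword : Fin size → Matrix κ κ ℂ
  codeword_isState : ∀ i, IsState (codeword i)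
  /-- The measurement operators of the decoder. -/
  effect : Fin size → Matrix η η ℂ
  effect_posSemidef : ∀ i, (effect i).PosSemidef
  sum_effect_le : (1 - ∑ i, effect i).PosSemidef

/-- The average probability of error of a code over a channel. -/
def Code.errorProb {κ η : Type*} [Fintype κ] [DecidableEq κ] [Fintype η] [DecidableEq η]
    (C : Code κ η) (Λ : Channel κ η) : ℝ :=
  (1 / (C.size : ℝ)) *
    ∑ i, (1 - (Λ.lin (C.codeword i) * C.effect i).trace.re)

/-- `R` is an achievable rate: there are codes with at least `e^{nR}` messages for all large `n`
whose average probability of error tends to zero. -/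
def IsAchievable {κ η : ℕ → Type*} [∀ n, Fintype (κ n)] [∀ n, DecidableEq (κ n)]
    [∀ n, Fintype (η n)] [∀ n, DecidableEq (η n)] (Λ : ∀ n, Channel (κ n) (η n)) (R : ℝ) : Prop :=
  ∃ C : ∀ n, Code (κ n) (η n),
    (∃ N : ℕ, ∀ n ≥ N, Real.exp (n * R) ≤ ((C n).size : ℝ)) ∧
      Tendsto (fun n => (C n).errorProb (Λ n)) atTop (𝓝 0)

/-- The classical capacity: the supremum of the achievable rates, as an extended real number. -/
def capacity {κ η : ℕ → Type*} [∀ n, Fintype (κ n)] [∀ n, DecidableEq (κ n)]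
    [∀ n, Fintype (η n)] [∀ n, DecidableEq (η n)] (Λ : ∀ n, Channel (κ n) (η n)) : EReal :=
  sSup {x : EReal | ∃ R : ℝ, x = (R : EReal) ∧ IsAchievable Λ R}

end QInfoSpectrum

end

namespace QInfoSpectrum

open Matrix

/-! ### Tests, spectral projections and the Hayashi–Nagaoka inequality. -/

section Operators

variable {ι : Type*} [Fintype ι] [DecidableEq ι]

section Order

open scoped MatrixOrder

/-! Both inequalities come from one-shot links between codes and tests that distinguish a joint
state `R` from the product of its marginals. The number `diffTrace` is the maximum over tests `P` of
`Tr[P R] - e^{nγ} Tr[P (R_A ⊗ R_H)]`.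

Direct part: for an input `∑ p_x σ_x ⊗ τ_x`, slicing the optimal test along `σ_x` gives a test `Q_x`
on the output alone. Its mean success on `W_x = Λ(τ_x)` is `Tr[P R]`, and its mean value for
independent pairs `(x, y)` is `Tr[P (R_A ⊗ R_H)]`. With about `e^{nγ}` codewords drawn independently
from `p` and decoded by the square-root measurement of the `Q_x`, the error is of order `1 -
diffTrace` (`exists_code_of_isSeparable`). So every `γ` admitted in the mutual information rate is
achievable.

Converse: on the classical-quantum state of a code of size `M`, the decoder is a test with value `1
- errorProb` on the joint state and at most `1/M` on the product (`Code.le_diffTrace_cqState`).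

Attainment: a diagonal argument yields one code sequence with vanishing error whose size is
eventually at least `e^{nR}` for every `R` below capacity (`exists_codes_capacity`). Its
classical-quantum states have rate at least the capacity, and at most the capacity by the direct
part. -/

theorem exists_posSemidef_mul_self_eq {A : Matrix ι ι ℂ} (hA : A.PosSemidef) :
    ∃ S : Matrix ι ι ℂ, S.PosSemidef ∧ S * S = A :=
  ⟨CFC.sqrt A, (CFC.sqrt_nonneg A).posSemidef, CFC.sqrt_mul_sqrt_self A hA.nonneg⟩

open scoped Matrix.Norms.L2Operator in
/-- Operator monotonicity of the square root. -/
theorem posSemidef_sub_of_mul_self {A B : Matrix ι ι ℂ} (hA : A.PosSemidef) (hB : B.PosSemidef)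
    (h : (B * B - A * A).PosSemidef) : (B - A).PosSemidef := by
  have := CFC.sqrt_le_sqrt (A * A) (B * B) h
  rwa [CFC.sqrt_mul_self A hA.nonneg, CFC.sqrt_mul_self B hB.nonneg] at this

end Order

theorem trace_mul_re_nonneg {A B : Matrix ι ι ℂ} (hA : A.PosSemidef) (hB : B.PosSemidef) :
    0 ≤ (A * B).trace.re := by
  obtain ⟨S, hS, rfl⟩ := exists_posSemidef_mul_self_eq hA
  have h := (hB.conjTranspose_mul_mul_same S).trace_nonneg
  rw [hS.isHermitian.eq, mul_assoc, trace_mul_comm, mul_assoc, trace_mul_comm] at h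
  simpa [mul_assoc] using (Complex.le_def.1 h).1

theorem trace_mul_re_le {A B C : Matrix ι ι ℂ} (hA : A.PosSemidef) (hBC : (C - B).PosSemidef) :
    (A * B).trace.re ≤ (A * C).trace.re := by
  have := trace_mul_re_nonneg hA hBC
  rwa [mul_sub, trace_sub, Complex.sub_re, sub_nonneg] at this

/-- A test (effect): an operator between zero and the identity. -/
structure IsTest (Q : Matrix ι ι ℂ) : Prop where
  posSemidef : Q.PosSemidef
  one_sub : (1 - Q).PosSemidef

/-- `Q - Q² = (1 - Q) Q (1 - Q) + Q (1 - Q) Q`. -/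
theorem IsTest.sub_mul_self {Q : Matrix ι ι ℂ} (hQ : IsTest Q) : (Q - Q * Q).PosSemidef := by
  have h1 := hQ.posSemidef.conjTranspose_mul_mul_same (1 - Q)
  have h2 := hQ.one_sub.conjTranspose_mul_mul_same Q
  rw [hQ.one_sub.isHermitian.eq] at h1
  rw [hQ.posSemidef.isHermitian.eq] at h2
  convert h1.add h2 using 1
  noncomm_ring

theorem cfc_posSemidef (f : ℝ → ℝ) (hf : ∀ x, 0 ≤ f x) (A : Matrix ι ι ℂ) :
    (cfc f A).PosSemidef := by
  open scoped MatrixOrder in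
  exact (cfc_nonneg fun x _ => hf x : 0 ≤ cfc f A).posSemidef

/-- Finiteness of the spectrum lets the functional calculus accept the discontinuous indicator in
`nonnegProj`. -/
theorem continuousOn_spectrum (f : ℝ → ℝ) (A : Matrix ι ι ℂ) :
    ContinuousOn f (spectrum ℝ A) :=
  (Matrix.finite_real_spectrum (A := A)).continuousOn f

theorem isTest_nonnegProj {A : Matrix ι ι ℂ} (hA : A.IsHermitian) : IsTest (nonnegProj A) := by
  refine ⟨cfc_posSemidef _ (fun x => Set.indicator_nonneg (fun _ _ => zero_le_one) x) A, ?_⟩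
  have h := cfc_sub (fun _ => (1 : ℝ)) (Set.indicator (Set.Ici (0 : ℝ)) (fun _ => (1 : ℝ))) A
    (continuousOn_spectrum _ A) (continuousOn_spectrum _ A)
  rw [cfc_const_one ℝ A (isHermitian_iff_isSelfAdjoint.1 hA)] at h
  rw [nonnegProj, ← h]
  refine cfc_posSemidef _ (fun x => ?_) A
  by_cases hx : (0 : ℝ) ≤ x <;> simp [Set.indicator, hx]

/-- The spectral projection `{A ≥ 0}` maximizes `Tr[Q A]` over the tests `Q`. -/
theorem trace_mul_re_le_nonnegProj {A Q : Matrix ι ι ℂ} (hA : A.IsHermitian) (hQ : IsTest Q) :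
    (Q * A).trace.re ≤ (nonnegProj A * A).trace.re := by
  have hid : cfc (id : ℝ → ℝ) A = A := cfc_id ℝ A hA
  -- The right side is `Tr A₊`. Then `Tr[Q A] ≤ Tr[Q A₊]` because `A₊ - A = A₋ ≥ 0`, and `Tr[Q A₊] ≤
  -- Tr A₊` because `Q ≤ 1`.
  have hpos : nonnegProj A * A = cfc (fun x : ℝ => max x 0) A := by
    conv_lhs => rw [nonnegProj]; arg 2; rw [← hid]
    rw [← cfc_mul _ _ A (continuousOn_spectrum _ A) (continuousOn_spectrum _ A)]
    congr 1
    ext x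
    by_cases hx : (0 : ℝ) ≤ x
    · simp [Set.indicator, hx]
    · simp [Set.indicator, hx, le_of_not_ge hx]
  have hneg : cfc (fun x : ℝ => max x 0) A - A = cfc (fun x : ℝ => max (-x) 0) A := by
    conv_lhs => arg 2; rw [← hid]
    rw [← cfc_sub _ _ A (continuousOn_spectrum _ A) (continuousOn_spectrum _ A)]
    congr 1
    ext x
    rcases le_total 0 x with hx | hx <;> simp [hx]
  rw [hpos]
  refine (trace_mul_re_le hQ.posSemidef (C := cfc (fun x : ℝ => max x 0) A) ?_).trans ?_
  · rw [hneg]; exact cfc_posSemidef _ (fun x => le_max_right _ _) A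
  · have := trace_mul_re_nonneg hQ.one_sub
      (cfc_posSemidef (fun x : ℝ => max x 0) (fun x => le_max_right _ _) A)
    rwa [sub_mul, one_mul, trace_sub, Complex.sub_re, sub_nonneg] at this

/-- The Hayashi–Nagaoka inequality, for an invertible `S + T = X²` with `G = X⁻¹`. -/
theorem hayashi_nagaoka {S T X G : Matrix ι ι ℂ} (hS : IsTest S) (hT : T.PosSemidef)
    (hX : X.PosSemidef) (hG : G.IsHermitian) (hXX : X * X = S + T) (hXG : X * G = 1)
    (hGX : G * X = 1) :
    ((2 : ℂ) • (1 - S) + (4 : ℂ) • T - (1 - G * S * G)).PosSemidef := by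
  -- `S² ≤ S ≤ S + T = X²`, and the square root is operator monotone.
  have hXS : (X - S).PosSemidef := by
    refine posSemidef_sub_of_mul_self hS.posSemidef hX ?_
    rw [hXX]
    convert hS.sub_mul_self.add hT using 1
    abel
  have h1 : (((G - 2 • 1)ᴴ) * T * (G - 2 • 1)).PosSemidef := hT.conjTranspose_mul_mul_same _
  have h2 : (((G - 1)ᴴ) * S * (G - 1)).PosSemidef := hS.posSemidef.conjTranspose_mul_mul_same _
  -- An exact sum-of-positives decomposition: the linear terms combine through `G (S + T) = X = (S +
  -- T) G`, the quadratic ones through `G (S + T) G = 1`.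
  have e : (2 : ℂ) • (1 - S) + (4 : ℂ) • T - (1 - G * S * G) =
      ((G - 2 • 1)ᴴ) * T * (G - 2 • 1) + (2 : ℂ) • (((G - 1)ᴴ) * S * (G - 1))
        + (4 : ℂ) • (X - S) := by
    have hGT : G * T = X - G * S := by
      rw [eq_sub_iff_add_eq', ← mul_add, ← hXX, ← mul_assoc, hGX, one_mul]
    have hTG : T * G = X - S * G := by
      rw [eq_sub_iff_add_eq', ← add_mul, ← hXX, mul_assoc, hXG, mul_one]
    simp only [conjTranspose_sub, hG.eq, conjTranspose_smul, conjTranspose_one, sub_mul, mul_sub,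
      one_mul, mul_one, smul_mul_assoc, mul_smul_comm, star_trivial, mul_assoc]
    simp only [hGT, hTG, mul_sub, hGX]
    module
  rw [e]
  exact (h1.add (h2.smul (by norm_num))).add (hXS.smul (by norm_num))

end Operators

/-! ### Partial traces, product mixtures and slices of tests. -/

section Bipartite

variable {α β κ η : Type*}

theorem idTensor_sum_kronecker {k : ℕ} (Φ : Matrix κ κ ℂ →ₗ[ℂ] Matrix η η ℂ) (p : Fin k → ℝ)
    (σ : Fin k → Matrix α α ℂ) (τ : Fin k → Matrix κ κ ℂ) :
    idTensor α Φ (∑ x, (p x : ℂ) • (σ x ⊗ₖ τ x)) = ∑ x, (p x : ℂ) • (σ x ⊗ₖ Φ (τ x)) := by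
  ext ⟨a, b⟩ ⟨a', b'⟩
  have h : (Matrix.of fun q q' => (∑ x, (p x : ℂ) • (σ x ⊗ₖ τ x)) (a, q) (a', q')) =
      ∑ x, ((p x : ℂ) * σ x a a') • τ x := by
    ext q q'
    simp [Matrix.sum_apply, mul_assoc]
  simp only [idTensor, of_apply, h, map_sum, map_smul]
  simp [Matrix.sum_apply, mul_assoc]

theorem reducedLeft_sum_kronecker [Fintype β] {k : ℕ} (p : Fin k → ℝ)
    (σ : Fin k → Matrix α α ℂ) (τ : Fin k → Matrix β β ℂ) (hτ : ∀ x, (τ x).trace = 1) :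
    reducedLeft (∑ x, (p x : ℂ) • (σ x ⊗ₖ τ x)) = ∑ x, (p x : ℂ) • σ x := by
  ext a a'
  simp only [reducedLeft, of_apply, Matrix.sum_apply, Matrix.smul_apply, kronecker_apply, smul_eq_mul]
  rw [Finset.sum_comm]
  refine Finset.sum_congr rfl fun x _ => ?_
  rw [← Finset.mul_sum, ← Finset.mul_sum, show ∑ b, τ x b b = 1 from hτ x, mul_one]

theorem reducedRight_sum_kronecker [Fintype α] {k : ℕ} (p : Fin k → ℝ)
    (σ : Fin k → Matrix α α ℂ) (τ : Fin k → Matrix β β ℂ) (hσ : ∀ x, (σ x).trace = 1) :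
    reducedRight (∑ x, (p x : ℂ) • (σ x ⊗ₖ τ x)) = ∑ x, (p x : ℂ) • τ x := by
  ext b b'
  simp only [reducedRight, of_apply, Matrix.sum_apply, Matrix.smul_apply, kronecker_apply, smul_eq_mul]
  rw [Finset.sum_comm]
  refine Finset.sum_congr rfl fun x _ => ?_
  rw [← Finset.mul_sum, ← Finset.sum_mul, show ∑ a, σ x a a = 1 from hσ x, one_mul]

theorem reducedRight_posSemidef [Fintype α] [Fintype β] {X : Matrix (α × β) (α × β) ℂ}
    (hX : X.PosSemidef) : (reducedRight X).PosSemidef := by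
  have : reducedRight X = ∑ a, X.submatrix (fun b => (a, b)) (fun b => (a, b)) := by
    ext b b'
    simp [reducedRight, Matrix.sum_apply]
  rw [this]
  exact posSemidef_sum _ fun a _ => hX.submatrix _

theorem reducedRight_sub [Fintype α] (X Y : Matrix (α × β) (α × β) ℂ) :
    reducedRight (X - Y) = reducedRight X - reducedRight Y := by
  ext b b'
  simp [reducedRight]

theorem reducedRight_kronecker [Fintype α] (A : Matrix α α ℂ) (B : Matrix β β ℂ) :
    reducedRight (A ⊗ₖ B) = A.trace • B := by
  ext b b'
  simp [reducedRight, Matrix.trace, Finset.sum_mul]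

theorem trace_reducedRight_mul [Fintype α] [DecidableEq α] [Fintype β]
    (X : Matrix (α × β) (α × β) ℂ) (Y : Matrix β β ℂ) :
    (reducedRight X * Y).trace = (X * ((1 : Matrix α α ℂ) ⊗ₖ Y)).trace := by
  have h : ∀ a b, (X * ((1 : Matrix α α ℂ) ⊗ₖ Y)) (a, b) (a, b) =
      ∑ b', X (a, b) (a, b') * Y b' b := by
    intro a b
    rw [mul_apply, Fintype.sum_prod_type, Finset.sum_eq_single a]
    · simp
    · intro a' _ ha
      simp [ha]
    · simp
  simp only [Matrix.trace, diag_apply, mul_apply, Fintype.sum_prod_type] at h ⊢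
  simp only [h, reducedRight, of_apply, Finset.sum_mul]
  exact (Finset.sum_congr rfl fun b _ => Finset.sum_comm).trans Finset.sum_comm

/-- A test on a bipartite system together with a state of the first factor induces a test on the
second factor. -/
theorem exists_isTest_slice [Fintype α] [DecidableEq α] [Fintype β] [DecidableEq β]
    {P : Matrix (α × β) (α × β) ℂ} (hP : IsTest P) {σ : Matrix α α ℂ} (hσ : IsState σ) :
    ∃ Q : Matrix β β ℂ, IsTest Q ∧ ∀ Y, (Q * Y).trace = (P * (σ ⊗ₖ Y)).trace := by
  obtain ⟨s, hs, hss⟩ := exists_posSemidef_mul_self_eq hσ.1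
  have hs1 : (s ⊗ₖ (1 : Matrix β β ℂ))ᴴ = s ⊗ₖ (1 : Matrix β β ℂ) := by
    rw [conjTranspose_kronecker, hs.isHermitian.eq, conjTranspose_one]
  -- `Q = Tr_A[(√σ ⊗ 1) P (√σ ⊗ 1)]`; since `Tr σ = 1`, `1 - Q` is the same expression with `1 - P`
  -- in place of `P`.
  refine ⟨reducedRight ((s ⊗ₖ (1 : Matrix β β ℂ))ᴴ * P * (s ⊗ₖ (1 : Matrix β β ℂ))),
    ⟨reducedRight_posSemidef (hP.posSemidef.conjTranspose_mul_mul_same _), ?_⟩, fun Y => ?_⟩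
  · convert reducedRight_posSemidef (hP.one_sub.conjTranspose_mul_mul_same
      (s ⊗ₖ (1 : Matrix β β ℂ))) using 1
    rw [mul_sub, sub_mul, reducedRight_sub, hs1, mul_one, ← mul_kronecker_mul, hss, mul_one,
      reducedRight_kronecker, hσ.2, one_smul]
  · rw [trace_reducedRight_mul, hs1, mul_assoc, mul_assoc, trace_mul_comm, mul_assoc, mul_assoc,
      ← mul_kronecker_mul, ← mul_kronecker_mul, one_mul, one_mul, mul_one, hss]

theorem sum_smul_kronecker {k : ℕ} (p : Fin k → ℝ) (σ : Fin k → Matrix α α ℂ) (Y : Matrix β β ℂ) :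
    (∑ x, (p x : ℂ) • σ x) ⊗ₖ Y = ∑ x, (p x : ℂ) • (σ x ⊗ₖ Y) := by
  ext ⟨a, b⟩ ⟨a', b'⟩
  simp [Matrix.sum_apply, Finset.sum_mul, mul_assoc]

end Bipartite

theorem isState_sum_smul {ι : Type*} [Fintype ι] {k : ℕ} {p : Fin k → ℝ} (hp : ∀ x, 0 ≤ p x)
    (hp1 : ∑ x, p x = 1) {τ : Fin k → Matrix ι ι ℂ} (hτ : ∀ x, IsState (τ x)) :
    IsState (∑ x, (p x : ℂ) • τ x) := by
  refine ⟨posSemidef_sum _ fun x _ => (hτ x).1.smul (by exact_mod_cast hp x), ?_⟩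
  simp only [trace_sum, trace_smul, (hτ _).2, smul_eq_mul, mul_one]
  exact_mod_cast hp1

theorem Channel.isState_lin {κ η : Type*} [Fintype κ] [DecidableEq κ] [Fintype η] [DecidableEq η]
    (Λ : Channel κ η) {τ : Matrix κ κ ℂ} (hτ : IsState τ) : IsState (Λ.lin τ) := by
  refine ⟨?_, (Λ.trace_map τ).trans hτ.2⟩
  open scoped MatrixOrder Matrix.Norms.L2Operator in
  exact (map_nonneg Λ.toCompletelyPositiveMap hτ.1.nonneg).posSemidef

/-! ### Square-root measurement and averaging over random codebooks. -/

section RandomCoding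

/-- The square-root measurement for a family of tests. -/
theorem exists_squareRoot_measurement {m ι : Type*} [Fintype m] [DecidableEq m] [Fintype ι]
    [DecidableEq ι]
    (Q W : m → Matrix ι ι ℂ) (hQ : ∀ i, IsTest (Q i)) (hW : ∀ i, IsState (W i)) {δ : ℝ}
    (hδ : 0 < δ) :
    ∃ E : m → Matrix ι ι ℂ, (∀ i, (E i).PosSemidef) ∧ (1 - ∑ i, E i).PosSemidef ∧
      ∀ i, 1 - (W i * E i).trace.re ≤ 2 * (1 - (W i * Q i).trace.re)
        + 4 * ∑ j ∈ Finset.univ.erase i, (W i * Q j).trace.re + 4 * δ := by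
  have hδ' : (0 : ℂ) < (δ : ℂ) := by exact_mod_cast hδ
  -- The term `δ • 1` makes the sum invertible. The effects `Z^{-1/2} Q_i Z^{-1/2}` then leave the
  -- failure outcome `δ Z⁻¹`.
  set Z : Matrix ι ι ℂ := ∑ i, Q i + (δ : ℂ) • 1 with hZ
  have hZpos : Z.PosDef :=
    PosDef.posSemidef_add (posSemidef_sum _ fun i _ => (hQ i).posSemidef) (PosDef.one.smul hδ')
  obtain ⟨X, hX, hXX⟩ := exists_posSemidef_mul_self_eq hZpos.posSemidef
  have hXu : IsUnit X := by
    have := hZpos.isUnit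
    rw [← hXX] at this
    exact isUnit_of_mul_isUnit_left this
  have hdet : IsUnit X.det := (isUnit_iff_isUnit_det X).1 hXu
  have hXG : X * X⁻¹ = 1 := mul_nonsing_inv X hdet
  have hGX : X⁻¹ * X = 1 := nonsing_inv_mul X hdet
  have hG : (X⁻¹).IsHermitian := hX.inv.isHermitian
  refine ⟨fun i => X⁻¹ * Q i * X⁻¹, fun i => ?_, ?_, fun i => ?_⟩
  · simpa [hG.eq] using (hQ i).posSemidef.conjTranspose_mul_mul_same X⁻¹
  · have : 1 - ∑ i, X⁻¹ * Q i * X⁻¹ = (δ : ℂ) • (X⁻¹ᴴ * X⁻¹) := by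
      have h1 : ∑ i, Q i = X * X - (δ : ℂ) • 1 := by rw [hXX, hZ]; abel
      rw [← Finset.sum_mul, ← Finset.mul_sum, h1, hG.eq, mul_sub, sub_mul, ← mul_assoc, hGX,
        one_mul, hXG]
      simp
    rw [this]
    exact (posSemidef_conjTranspose_mul_self _).smul hδ'.le
  -- For message `i` everything else, including the regularization, goes into `T`; this is the
  -- source of the `4 * δ`.
  · set T : Matrix ι ι ℂ := ∑ j ∈ Finset.univ.erase i, Q j + (δ : ℂ) • 1 with hT
    have hTpos : T.PosSemidef :=
      (posSemidef_sum _ fun j _ => (hQ j).posSemidef).add (PosSemidef.one.smul hδ'.le)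
    have hZT : X * X = Q i + T := by
      rw [hXX, hZ, hT, ← Finset.add_sum_erase _ _ (Finset.mem_univ i), add_assoc]
    have h := trace_mul_re_nonneg (hW i).1 (hayashi_nagaoka (hQ i) hTpos hX hG hZT hXG hGX)
    simp only [mul_sub, mul_add, hT, mul_smul_comm, mul_one, Finset.mul_sum, trace_sub, trace_add,
      trace_smul, trace_sum, (hW i).2, Complex.sub_re, Complex.add_re, Complex.re_sum,
      smul_eq_mul, Complex.mul_re, Complex.one_re, Complex.ofReal_re, Complex.ofReal_im,
      Complex.re_ofNat, Complex.im_ofNat, zero_mul, sub_zero] at h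
    simp only [Finset.mul_sum]
    linarith

variable {m X : Type*} [Fintype m] [DecidableEq m] [Fintype X]

/-- Independence of the codewords: the expectation of a product over coordinates factors. Setting
all but one or two factors to `1` gives the marginal laws below. -/
theorem sum_prod_mul_prod (p : X → ℝ) (h : m → X → ℝ) :
    ∑ x : m → X, (∏ l, p (x l)) * ∏ l, h l (x l) = ∏ l, ∑ a, p a * h l a := by
  rw [Finset.prod_univ_sum]
  simp [Finset.prod_mul_distrib]

theorem sum_prod_mul_apply {p : X → ℝ} (hp : ∑ a, p a = 1) (f : X → ℝ) (i : m) :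
    ∑ x : m → X, (∏ l, p (x l)) * f (x i) = ∑ a, p a * f a := by
  have h := sum_prod_mul_prod p (fun l a => if l = i then f a else 1)
  simp only [Finset.prod_ite_eq', Finset.mem_univ, if_true] at h
  rw [h, Finset.prod_eq_single i]
  · simp
  · intro l _ hl; simp [hl, hp]
  · simp

theorem sum_prod_mul_apply_mul_apply {p : X → ℝ} (hp : ∑ a, p a = 1) (f g : X → ℝ) {i j : m}
    (hij : i ≠ j) :
    ∑ x : m → X, (∏ l, p (x l)) * (f (x i) * g (x j)) = (∑ a, p a * f a) * ∑ a, p a * g a := by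
  have h := sum_prod_mul_prod p (fun l a => (if l = i then f a else 1) * if l = j then g a else 1)
  simp only [Finset.prod_mul_distrib, Finset.prod_ite_eq', Finset.mem_univ, if_true] at h
  rw [h, ← Finset.mul_prod_erase _ _ (Finset.mem_univ i),
    ← Finset.mul_prod_erase _ _ (Finset.mem_erase.2 ⟨hij.symm, Finset.mem_univ j⟩),
    Finset.prod_eq_one, mul_one]
  · simp [hij, hij.symm]
  · intro l hl
    simp only [Finset.mem_erase] at hl
    simp [hl, hp]

theorem sum_prod_mul_apply_apply {p : X → ℝ} (hp : ∑ a, p a = 1) (f : X → X → ℝ) {i j : m}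
    (hij : i ≠ j) :
    ∑ x : m → X, (∏ l, p (x l)) * f (x i) (x j) = ∑ a, ∑ b, p a * p b * f a b := by
  classical
  -- Conditioning on `x i = a` reduces a joint function to a sum of product functions.
  have h : ∀ x : m → X, (∏ l, p (x l)) * f (x i) (x j) =
      ∑ a, (∏ l, p (x l)) * ((if x i = a then 1 else 0) * f a (x j)) := fun x => by simp
  simp_rw [h]
  rw [Finset.sum_comm]
  refine Finset.sum_congr rfl fun a _ => ?_
  rw [sum_prod_mul_apply_mul_apply hp (fun y => if y = a then 1 else 0) (f a) hij]
  simp [Finset.mul_sum, mul_assoc]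

theorem exists_le_of_sum_mul_le {Y : Type*} [Fintype Y] {w F : Y → ℝ} (hw : ∀ y, 0 ≤ w y)
    (hw1 : ∑ y, w y = 1) {c : ℝ} (h : ∑ y, w y * F y ≤ c) : ∃ y, F y ≤ c := by
  by_contra! hF
  have h0 : ∑ y, w y * (F y - c) = 0 := by
    refine le_antisymm ?_ (Finset.sum_nonneg fun y _ => mul_nonneg (hw y) (sub_nonneg.2 (hF y).le))
    simp only [mul_sub, Finset.sum_sub_distrib, ← Finset.sum_mul, hw1]
    linarith
  rw [Finset.sum_eq_zero_iff_of_nonneg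
    fun y _ => mul_nonneg (hw y) (sub_nonneg.2 (hF y).le)] at h0
  have : ∑ y, w y = 0 := Finset.sum_eq_zero fun y hy =>
    (mul_eq_zero.1 (h0 y hy)).resolve_right (sub_pos.2 (hF y)).ne'
  linarith

/-- Random coding: some codebook, decoded by the square-root measurement, performs at least as well
as the average over independent codewords. -/
theorem exists_codebook {ι : Type*} [Fintype ι] [DecidableEq ι] [Nonempty m]
    {p : X → ℝ} (hp : ∀ a, 0 ≤ p a) (hp1 : ∑ a, p a = 1) {Q W : X → Matrix ι ι ℂ}
    (hQ : ∀ a, IsTest (Q a)) (hW : ∀ a, IsState (W a)) {δ : ℝ} (hδ : 0 < δ) :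
    ∃ (x : m → X) (E : m → Matrix ι ι ℂ), (∀ i, (E i).PosSemidef) ∧
      (1 - ∑ i, E i).PosSemidef ∧
      (1 / (Fintype.card m : ℝ)) * ∑ i, (1 - (W (x i) * E i).trace.re) ≤
        2 * (1 - ∑ a, p a * (W a * Q a).trace.re)
          + 4 * ((Fintype.card m : ℝ) - 1) * (∑ a, ∑ b, p a * p b * (W a * Q b).trace.re)
          + 4 * δ := by
  set A : ℝ := ∑ a, p a * (W a * Q a).trace.re with hA
  set B : ℝ := ∑ a, ∑ b, p a * p b * (W a * Q b).trace.re with hB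
  set F : (m → X) → ℝ := fun x => ∑ i, (2 * (1 - (W (x i) * Q (x i)).trace.re)
        + 4 * ∑ j ∈ Finset.univ.erase i, (W (x i) * Q (x j)).trace.re + 4 * δ) with hF
  have hw1 : ∑ x : m → X, ∏ l, p (x l) = 1 := by
    simpa [hp1] using sum_prod_mul_prod (m := m) p (fun _ _ => 1)
  have hcard : (0 : ℝ) < Fintype.card m := by exact_mod_cast Fintype.card_pos
  have havg : ∑ x : m → X, (∏ l, p (x l)) * F x =
      Fintype.card m * (2 * (1 - A) + 4 * ((Fintype.card m : ℝ) - 1) * B + 4 * δ) := by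
    simp only [hF, Finset.mul_sum (s := Finset.univ)]
    rw [Finset.sum_comm]
    have : ∀ i : m, ∑ x : m → X, (∏ l, p (x l)) * (2 * (1 - (W (x i) * Q (x i)).trace.re)
        + 4 * ∑ j ∈ Finset.univ.erase i, (W (x i) * Q (x j)).trace.re + 4 * δ) =
        2 * (1 - A) + 4 * ((Fintype.card m : ℝ) - 1) * B + 4 * δ := by
      intro i
      have h1 : ∀ x : m → X, (∏ l, p (x l)) * (2 * (1 - (W (x i) * Q (x i)).trace.re)
          + 4 * ∑ j ∈ Finset.univ.erase i, (W (x i) * Q (x j)).trace.re + 4 * δ) =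
          (2 + 4 * δ) * (∏ l, p (x l))
          - 2 * ((∏ l, p (x l)) * (W (x i) * Q (x i)).trace.re)
          + 4 * ∑ j ∈ Finset.univ.erase i,
            (∏ l, p (x l)) * (W (x i) * Q (x j)).trace.re := by
        intro x
        rw [← Finset.mul_sum]
        ring
      simp only [h1, Finset.sum_add_distrib, Finset.sum_sub_distrib, ← Finset.mul_sum, hw1]
      -- Distinct codewords are independent, so each of the `card m - 1` competitors contributes `B`
      -- on average.
      have h2 : ∑ x : m → X, (∏ l, p (x l)) *
          ∑ j ∈ Finset.univ.erase i, (W (x i) * Q (x j)).trace.re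
          = ((Fintype.card m : ℝ) - 1) * B := by
        simp only [Finset.mul_sum]
        rw [Finset.sum_comm]
        rw [Finset.sum_congr rfl fun j hj => sum_prod_mul_apply_apply hp1
          (fun a b => (W a * Q b).trace.re) (Finset.ne_of_mem_erase hj).symm]
        rw [Finset.sum_const, Finset.card_erase_of_mem (Finset.mem_univ i), Finset.card_univ,
          nsmul_eq_mul, Nat.cast_pred Fintype.card_pos]
      rw [sum_prod_mul_apply hp1 (fun a => (W a * Q a).trace.re) i, h2]
      ring
    rw [Finset.sum_congr rfl fun i _ => this i, Finset.sum_const, Finset.card_univ, nsmul_eq_mul]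
  obtain ⟨x, hx⟩ := exists_le_of_sum_mul_le (fun x => Finset.prod_nonneg fun l _ => hp (x l)) hw1
    havg.le
  obtain ⟨E, hE, hE1, hEi⟩ := exists_squareRoot_measurement (fun i => Q (x i)) (fun i => W (x i))
    (fun i => hQ _) (fun i => hW _) hδ
  refine ⟨x, E, hE, hE1, ?_⟩
  rw [one_div, inv_mul_le_iff₀ hcard]
  exact (Finset.sum_le_sum fun i _ => hEi i).trans hx

end RandomCoding

/-! ### Variational bounds for the trace of the positive part. -/

section DiffTrace

theorem isHermitian_diffOp {ι : Type*} {ρ ω : Matrix ι ι ℂ} (n : ℕ) (γ : ℝ) (hρ : ρ.PosSemidef) (hω : ω.PosSemidef) :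
    (diffOp n γ ρ ω).IsHermitian :=
  hρ.isHermitian.sub (hω.smul (by exact_mod_cast (Real.exp_pos _).le)).isHermitian

variable {ι : Type*} [Fintype ι] [DecidableEq ι] {ρ ω : Matrix ι ι ℂ}

theorem trace_mul_diffOp_re (n : ℕ) (γ : ℝ) (Q : Matrix ι ι ℂ) :
    (Q * diffOp n γ ρ ω).trace.re =
      (Q * ρ).trace.re - Real.exp (n * γ) * (Q * ω).trace.re := by
  simp only [diffOp, mul_sub, mul_smul_comm, trace_sub, trace_smul, Complex.sub_re, smul_eq_mul,
    Complex.re_ofReal_mul]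

theorem IsTest.trace_mul_re_le_one {Q : Matrix ι ι ℂ} (hQ : IsTest Q) (hρ : IsState ρ) :
    (Q * ρ).trace.re ≤ 1 := by
  have := trace_mul_re_le hρ.1 hQ.one_sub
  rwa [mul_one, hρ.2, trace_mul_comm] at this

theorem le_diffTrace (n : ℕ) (γ : ℝ) (hρ : ρ.PosSemidef) (hω : ω.PosSemidef) {Q : Matrix ι ι ℂ}
    (hQ : IsTest Q) :
    (Q * ρ).trace.re - Real.exp (n * γ) * (Q * ω).trace.re ≤ diffTrace n γ ρ ω := by
  rw [← trace_mul_diffOp_re]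
  exact trace_mul_re_le_nonnegProj (isHermitian_diffOp n γ hρ hω) hQ

theorem diffTrace_le_one (n : ℕ) (γ : ℝ) (hρ : IsState ρ) (hω : ω.PosSemidef) :
    diffTrace n γ ρ ω ≤ 1 := by
  have hP := isTest_nonnegProj (isHermitian_diffOp n γ hρ.1 hω)
  rw [diffTrace, trace_mul_diffOp_re]
  have h1 := hP.trace_mul_re_le_one hρ
  have h2 := mul_nonneg (Real.exp_pos (n * γ)).le (trace_mul_re_nonneg hP.posSemidef hω)
  linarith

end DiffTrace

/-- The bound `u ≤ 1` controls the limsup, so the liminf condition in the rate becomes ordinary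
convergence. -/
theorem liminf_eq_one_iff_tendsto {u : ℕ → ℝ} (hu : ∀ n, u n ≤ 1) :
    liminf (fun n => (u n : EReal)) atTop = 1 ↔ Tendsto u atTop (𝓝 1) := by
  constructor
  · intro h
    have h1 : Tendsto (fun n => (u n : EReal)) atTop (𝓝 ((1 : ℝ) : EReal)) :=
      tendsto_of_le_liminf_of_limsup_le h.ge
        (limsup_le_of_le (h := Eventually.of_forall fun n => by exact_mod_cast hu n))
    exact EReal.tendsto_coe.1 h1
  · intro h
    exact (EReal.tendsto_coe.2 h).liminf_eq

/-! ### One-shot direct and converse coding bounds. -/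

section Code

variable {κ η : Type*} [Fintype κ] [Fintype η] [DecidableEq η]

/-- `1 - E_i` is the failure operator plus the other effects. -/
theorem Code.isTest_effect (C : Code κ η) (i : Fin C.size) : IsTest (C.effect i) := by
  refine ⟨C.effect_posSemidef i, ?_⟩
  convert C.sum_effect_le.add
    (posSemidef_sum (Finset.univ.erase i) fun j _ => C.effect_posSemidef j) using 1
  rw [← Finset.add_sum_erase _ _ (Finset.mem_univ i)]
  abel

theorem Code.sum_inv_size (C : Code κ η) : ∑ _i : Fin C.size, (C.size : ℝ)⁻¹ = 1 := by
  have : (C.size : ℝ) ≠ 0 := by exact_mod_cast C.size_pos.ne'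
  simp [this]

/-- The classical-quantum state of a uniformly random message and its codeword. -/
noncomputable def Code.cqState (C : Code κ η) : Matrix (Fin C.size × κ) (Fin C.size × κ) ℂ :=
  ∑ i, (((C.size : ℝ)⁻¹ : ℝ) : ℂ) • (Matrix.single i i 1 ⊗ₖ C.codeword i)

theorem isState_single {m : Type*} [Fintype m] [DecidableEq m] (i : m) :
    IsState (Matrix.single i i (1 : ℂ)) := by
  refine ⟨?_, by simp⟩
  rw [← diagonal_single]
  exact PosSemidef.diagonal (Pi.single_nonneg.2 zero_le_one)

theorem Code.isSeparable_cqState (C : Code κ η) : IsSeparable C.cqState :=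
  ⟨C.size, fun _ => (C.size : ℝ)⁻¹, fun i => Matrix.single i i 1, C.codeword,
    fun _ => by positivity, C.sum_inv_size, isState_single, C.codeword_isState, rfl⟩

/-- Controlled on the message, the test applies the corresponding effect of the decoder. -/
theorem Code.exists_isTest_message (C : Code κ η) :
    ∃ T : Matrix (Fin C.size × η) (Fin C.size × η) ℂ, IsTest T ∧
      ∀ x Y, (T * (Matrix.single x x (1 : ℂ) ⊗ₖ Y)).trace = (C.effect x * Y).trace := by
  refine ⟨∑ i, Matrix.single i i (1 : ℂ) ⊗ₖ C.effect i, ?_, ?_⟩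
  · refine ⟨posSemidef_sum _ fun i _ => (isState_single i).1.kronecker (C.effect_posSemidef i), ?_⟩
    have h : 1 - ∑ i, Matrix.single i i (1 : ℂ) ⊗ₖ C.effect i =
        ∑ i, Matrix.single i i (1 : ℂ) ⊗ₖ (1 - C.effect i) := by
      rw [sub_eq_iff_eq_add, ← Finset.sum_add_distrib]
      simp only [← kronecker_add, sub_add_cancel]
      ext ⟨a, b⟩ ⟨a', b'⟩
      by_cases h : a = a'
      · simp [Matrix.sum_apply, Matrix.single_apply, one_apply, h]
      · have h' : ∀ i, ¬(i = a ∧ i = a') := by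
          rintro i ⟨rfl, rfl⟩
          exact h rfl
        simp [Matrix.sum_apply, one_apply, h, h']
    rw [h]
    exact posSemidef_sum _ fun i _ => (isState_single i).1.kronecker (C.isTest_effect i).one_sub
  · intro x Y
    rw [Finset.sum_mul, trace_sum, Finset.sum_eq_single x]
    · rw [← mul_kronecker_mul, trace_kronecker]
      simp
    · intro i _ hi
      rw [← mul_kronecker_mul, single_mul_single_of_ne _ _ _ _ hi, zero_kronecker, trace_zero]
    · simp

variable [DecidableEq κ]

theorem Code.errorProb_nonneg (C : Code κ η) (Λ : Channel κ η) : 0 ≤ C.errorProb Λ := by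
  refine mul_nonneg (by positivity) (Finset.sum_nonneg fun i _ => ?_)
  have := (C.isTest_effect i).trace_mul_re_le_one (Λ.isState_lin (C.codeword_isState i))
  rw [trace_mul_comm] at this
  linarith

/-- One-shot direct coding theorem: a separable input state yields codes whose error is controlled
by the trace of the positive part of the difference operator. -/
theorem exists_code_of_isSeparable {α : Type*} [Fintype α] [DecidableEq α] (Λ : Channel κ η)
    {ρ : Matrix (α × κ) (α × κ) ℂ} (hρ : IsSeparable ρ) (n : ℕ) (γ : ℝ) {δ : ℝ} (hδ : 0 < δ) :
    ∃ C : Code κ η, Real.exp (n * γ) ≤ C.size ∧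
      C.errorProb Λ ≤ 6 * (1 - diffTrace n γ (idTensor α Λ.lin ρ)
        (reducedLeft (idTensor α Λ.lin ρ) ⊗ₖ reducedRight (idTensor α Λ.lin ρ))) + 4 * δ := by
  obtain ⟨k, p, σ, τ, hp, hp1, hσ, hτ, rfl⟩ := hρ
  set W : Fin k → Matrix η η ℂ := fun x => Λ.lin (τ x) with hW
  have hWs : ∀ x, IsState (W x) := fun x => Λ.isState_lin (hτ x)
  rw [idTensor_sum_kronecker, reducedLeft_sum_kronecker _ _ _ fun x => (hWs x).2,
    reducedRight_sum_kronecker _ _ _ fun x => (hσ x).2]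
  set R : Matrix (α × η) (α × η) ℂ := ∑ x, (p x : ℂ) • (σ x ⊗ₖ W x) with hR
  set O : Matrix η η ℂ := ∑ x, (p x : ℂ) • W x with hO
  have hRs : IsState R := isState_sum_smul hp hp1 fun x =>
    ⟨(hσ x).1.kronecker (hWs x).1, by rw [trace_kronecker, (hσ x).2, (hWs x).2, one_mul]⟩
  have hOs : IsState O := isState_sum_smul hp hp1 hWs
  have hσp : (∑ x, (p x : ℂ) • σ x).PosSemidef := (isState_sum_smul hp hp1 hσ).1
  have hP := isTest_nonnegProj (isHermitian_diffOp n γ hRs.1 (hσp.kronecker hOs.1))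
  have hval := trace_mul_diffOp_re (ρ := R) (ω := (∑ x, (p x : ℂ) • σ x) ⊗ₖ O) n γ
    (nonnegProj (diffOp n γ R ((∑ x, (p x : ℂ) • σ x) ⊗ₖ O)))
  rw [← diffTrace] at hval
  generalize nonnegProj (diffOp n γ R ((∑ x, (p x : ℂ) • σ x) ⊗ₖ O)) = P at hP hval
  choose Q hQ hQP using fun x => exists_isTest_slice hP (hσ x)
  have hPR : (P * R).trace.re = ∑ a, p a * (W a * Q a).trace.re := by
    simp only [hR, Finset.mul_sum, mul_smul_comm, trace_sum, trace_smul, Complex.re_sum,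
      smul_eq_mul, Complex.re_ofReal_mul, ← hQP, trace_mul_comm (W _)]
  have hPO : (P * ((∑ x, (p x : ℂ) • σ x) ⊗ₖ O)).trace.re =
      ∑ a, ∑ b, p a * p b * (W a * Q b).trace.re := by
    rw [sum_smul_kronecker, Finset.sum_comm]
    simp only [hO, Finset.mul_sum, mul_smul_comm, trace_sum, trace_smul, Complex.re_sum,
      smul_eq_mul, Complex.re_ofReal_mul, ← hQP, trace_mul_comm (W _)]
    exact Finset.sum_congr rfl fun b _ => Finset.sum_congr rfl fun a _ => by ring
  have hPR1 := hP.trace_mul_re_le_one hRs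
  have hPO0 := trace_mul_re_nonneg hP.posSemidef (hσp.kronecker hOs.1)
  set M : ℕ := ⌈Real.exp (n * γ)⌉₊ with hM
  have hMpos : 0 < M := Nat.ceil_pos.2 (Real.exp_pos _)
  have : Nonempty (Fin M) := ⟨⟨0, hMpos⟩⟩
  obtain ⟨x, E, hE, hE1, herr⟩ := exists_codebook (m := Fin M) hp hp1 hQ hWs hδ
  refine ⟨⟨M, hMpos, fun i => τ (x i), fun i => hτ _, E, hE, hE1⟩, Nat.le_ceil _, ?_⟩
  rw [Fintype.card_fin, ← hPR, ← hPO] at herr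
  -- Both `1 - Tr[P R]` and `e^{nγ} Tr[P (R_A ⊗ R_H)]` are at most `1 - diffTrace`; their weights 2
  -- and 4 add up to 6.
  refine herr.trans ?_
  have hM1 : (M : ℝ) - 1 ≤ Real.exp (n * γ) := by
    linarith [Nat.ceil_lt_add_one (Real.exp_pos (n * γ)).le]
  have := mul_le_mul_of_nonneg_right hM1 hPO0
  have := mul_nonneg (Real.exp_pos (n * γ)).le hPO0
  linarith

/-- One-shot converse: the code provides a test which distinguishes the joint state of message and
output from the product of its reduced states. -/
theorem Code.le_diffTrace_cqState (C : Code κ η) (Λ : Channel κ η) (n : ℕ) (γ : ℝ) :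
    1 - C.errorProb Λ - Real.exp (n * γ) / C.size ≤
      diffTrace n γ (idTensor (Fin C.size) Λ.lin C.cqState)
        (reducedLeft (idTensor (Fin C.size) Λ.lin C.cqState) ⊗ₖ
          reducedRight (idTensor (Fin C.size) Λ.lin C.cqState)) := by
  set W : Fin C.size → Matrix η η ℂ := fun x => Λ.lin (C.codeword x) with hW
  have hWs : ∀ x, IsState (W x) := fun x => Λ.isState_lin (C.codeword_isState x)
  have hσ : ∀ i : Fin C.size, IsState (Matrix.single i i (1 : ℂ)) := isState_single
  have hp : ∀ _x : Fin C.size, (0 : ℝ) ≤ (C.size : ℝ)⁻¹ := fun _ => by positivity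
  have hp1 := C.sum_inv_size
  rw [Code.cqState, idTensor_sum_kronecker (p := fun _ => (C.size : ℝ)⁻¹),
    reducedLeft_sum_kronecker (p := fun _ => (C.size : ℝ)⁻¹) _ _ fun x => (hWs x).2,
    reducedRight_sum_kronecker (p := fun _ => (C.size : ℝ)⁻¹) _ _ fun x => (hσ x).2]
  have hRs : IsState (∑ x, (((C.size : ℝ)⁻¹ : ℝ) : ℂ) • (Matrix.single x x (1 : ℂ) ⊗ₖ W x)) :=
    isState_sum_smul hp hp1 fun x =>
      ⟨(hσ x).1.kronecker (hWs x).1, by rw [trace_kronecker, (hσ x).2, (hWs x).2, one_mul]⟩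
  have hOs : IsState (∑ x, (((C.size : ℝ)⁻¹ : ℝ) : ℂ) • W x) := isState_sum_smul hp hp1 hWs
  have hσp := (isState_sum_smul hp hp1 hσ).1
  obtain ⟨T, hP, htr⟩ := C.exists_isTest_message
  refine le_trans ?_ (le_diffTrace n γ hRs.1 (hσp.kronecker hOs.1) hP)
  have hMpos : (0 : ℝ) < C.size := by exact_mod_cast C.size_pos
  have h1 : (T *
      ∑ x, (((C.size : ℝ)⁻¹ : ℝ) : ℂ) • (Matrix.single x x (1 : ℂ) ⊗ₖ W x)).trace.re =
      1 - C.errorProb Λ := by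
    simp only [Matrix.mul_sum, mul_smul_comm, trace_sum,
      trace_smul, htr, Complex.re_sum, smul_eq_mul, Complex.re_ofReal_mul, Code.errorProb,
      trace_mul_comm (C.effect _)]
    simp only [Finset.sum_sub_distrib, Finset.sum_const, Finset.card_univ, Fintype.card_fin,
      nsmul_eq_mul, mul_one, ← Finset.mul_sum, hW]
    field_simp
    ring
  -- On the product state the output `O` is independent of the message, so the value is `M⁻¹ Tr[(∑
  -- E_x) O] ≤ M⁻¹`.
  have h2 : (T *
      ((∑ x, (((C.size : ℝ)⁻¹ : ℝ) : ℂ) • Matrix.single x x (1 : ℂ)) ⊗ₖ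
        ∑ x, (((C.size : ℝ)⁻¹ : ℝ) : ℂ) • W x)).trace.re ≤ (C.size : ℝ)⁻¹ := by
    rw [sum_smul_kronecker (p := fun _ => (C.size : ℝ)⁻¹)]
    generalize ∑ x, (((C.size : ℝ)⁻¹ : ℝ) : ℂ) • W x = O at hOs
    simp only [Matrix.mul_sum, mul_smul_comm, trace_sum,
      trace_smul, htr, Complex.re_sum, smul_eq_mul, Complex.re_ofReal_mul]
    rw [← Finset.mul_sum, ← Complex.re_sum, ← trace_sum, ← Finset.sum_mul]
    have := trace_mul_re_le hOs.1 C.sum_effect_le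
    rw [mul_one, hOs.2, trace_mul_comm, Complex.one_re] at this
    exact mul_le_of_le_one_right (by positivity) this
  rw [h1]
  have := mul_le_mul_of_nonneg_left h2 (Real.exp_pos (n * γ)).le
  rw [← div_eq_mul_inv] at this
  linarith

end Code

/-! ### Diagonal selection. -/

section Diagonal

/-- Take `k n` to be the largest `k ≤ n` for which `Q k` holds from `n` onwards. -/
theorem exists_diagonal {Q : ℕ → ℕ → Prop} (hQ : ∀ k, ∀ᶠ n in atTop, Q k n) :
    ∃ k : ℕ → ℕ, Tendsto k atTop atTop ∧ ∀ᶠ n in atTop, Q (k n) n := by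
  classical
  refine ⟨fun n => Nat.findGreatest (fun k => ∀ m ≥ n, Q k m) n, ?_, ?_⟩
  · refine tendsto_atTop.2 fun K => ?_
    obtain ⟨N, hN⟩ := eventually_atTop.1 (hQ K)
    filter_upwards [eventually_ge_atTop (max K N)] with n hn
    exact Nat.le_findGreatest (le_of_max_le_left hn)
      fun m hm => hN m ((le_of_max_le_right hn).trans hm)
  -- `Nat.findGreatest` defaults to `0`, so its property is guaranteed only once `Q 0` holds from
  -- `n` onwards.
  · obtain ⟨N, hN⟩ := eventually_atTop.1 (hQ 0)
    filter_upwards [eventually_ge_atTop N] with n hn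
    exact Nat.findGreatest_spec (P := fun k => ∀ m ≥ n, Q k m) (Nat.zero_le n)
      (fun m hm => hN m (hn.trans hm)) n le_rfl

end Diagonal

/-! ### Asymptotics: direct part, converse and attainment. -/

section Capacity

variable {κ η : ℕ → Type*} [∀ n, Fintype (κ n)] [∀ n, DecidableEq (κ n)]
    [∀ n, Fintype (η n)] [∀ n, DecidableEq (η n)] (Λ : ∀ n, Channel (κ n) (η n))

theorem isAchievable_of_tendsto {d : ℕ → ℕ}
    {ρ : ∀ n, Matrix (Fin (d n) × κ n) (Fin (d n) × κ n) ℂ} (hρ : ∀ n, IsSeparable (ρ n)) {γ : ℝ}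
    (h : Tendsto (fun n => diffTrace n γ (idTensor (Fin (d n)) (Λ n).lin (ρ n))
      (reducedLeft (idTensor (Fin (d n)) (Λ n).lin (ρ n)) ⊗ₖ
        reducedRight (idTensor (Fin (d n)) (Λ n).lin (ρ n)))) atTop (𝓝 1)) :
    IsAchievable Λ γ := by
  choose C hC hCe using fun n => exists_code_of_isSeparable (Λ n) (hρ n) n γ
    (δ := 1 / ((n : ℝ) + 1)) (by positivity)
  refine ⟨C, ⟨0, fun n _ => hC n⟩, squeeze_zero (fun n => (C n).errorProb_nonneg _) hCe ?_⟩
  simpa using ((h.const_sub 1).const_mul 6).add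
    ((tendsto_one_div_add_atTop_nhds_zero_nat (𝕜 := ℝ)).const_mul 4)

theorem IsSeparable.isState_idTensor {α κ η : Type*} [Fintype α] [Fintype κ] [DecidableEq κ]
    [Fintype η] [DecidableEq η] (Λ : Channel κ η) {ρ : Matrix (α × κ) (α × κ) ℂ}
    (hρ : IsSeparable ρ) :
    IsState (idTensor α Λ.lin ρ) ∧ (reducedLeft (idTensor α Λ.lin ρ) ⊗ₖ
      reducedRight (idTensor α Λ.lin ρ)).PosSemidef := by
  obtain ⟨k, p, σ, τ, hp, hp1, hσ, hτ, rfl⟩ := hρ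
  have hW : ∀ x, IsState (Λ.lin (τ x)) := fun x => Λ.isState_lin (hτ x)
  rw [idTensor_sum_kronecker, reducedLeft_sum_kronecker _ _ _ fun x => (hW x).2,
    reducedRight_sum_kronecker _ _ _ fun x => (hσ x).2]
  refine ⟨isState_sum_smul hp hp1 fun x =>
    ⟨(hσ x).1.kronecker (hW x).1, by rw [trace_kronecker, (hσ x).2, (hW x).2, one_mul]⟩,
    (isState_sum_smul hp hp1 hσ).1.kronecker (isState_sum_smul hp hp1 hW).1⟩

theorem infMutualInfoRate_le_capacity {d : ℕ → ℕ}
    {ρ : ∀ n, Matrix (Fin (d n) × κ n) (Fin (d n) × κ n) ℂ} (hρ : ∀ n, IsSeparable (ρ n)) :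
    infMutualInfoRate (fun n => idTensor (Fin (d n)) (Λ n).lin (ρ n)) ≤ capacity Λ := by
  refine sSup_le ?_
  rintro _ ⟨γ, rfl, h⟩
  refine le_sSup ⟨γ, rfl, isAchievable_of_tendsto Λ hρ ?_⟩
  exact (liminf_eq_one_iff_tendsto fun n => diffTrace_le_one n γ
    ((hρ n).isState_idTensor (Λ n)).1 ((hρ n).isState_idTensor (Λ n)).2).1 h

/-- One message and the identity effect give zero error; this makes the set of achievable rates
nonempty, so some sequence in it tends to its supremum. -/
theorem isAchievable_zero [∀ n, Nonempty (κ n)] : IsAchievable Λ 0 := by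
  have hs : ∀ n, IsState (Matrix.single (Classical.arbitrary (κ n)) (Classical.arbitrary (κ n))
    (1 : ℂ)) := fun n => isState_single _
  refine ⟨fun n => ⟨1, one_pos, fun _ => _, fun _ => hs n, fun _ => 1, fun _ => PosSemidef.one,
    by simpa using PosSemidef.zero⟩, ⟨0, fun n _ => by simp⟩, ?_⟩
  have : ∀ n, ((Λ n).lin (Matrix.single (Classical.arbitrary (κ n)) (Classical.arbitrary (κ n))
    (1 : ℂ))).trace = 1 := fun n => ((Λ n).isState_lin (hs n)).2
  simp [Code.errorProb, this]

/-- The capacity need not itself be an achievable rate, and may be infinite. Diagonalizing over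
rates `r k` tending to it, with errors at most `1/(k+1)`, gives one sequence that serves all `R`
below it. -/
theorem exists_codes_capacity [∀ n, Nonempty (κ n)] :
    ∃ C : ∀ n, Code (κ n) (η n), Tendsto (fun n => (C n).errorProb (Λ n)) atTop (𝓝 0) ∧
      ∀ R : ℝ, (R : EReal) < capacity Λ → ∀ᶠ n : ℕ in atTop, Real.exp (n * R) ≤ (C n).size := by
  obtain ⟨u, -, hu, hmem⟩ := exists_seq_tendsto_sSup
    (S := {x : EReal | ∃ R : ℝ, x = (R : EReal) ∧ IsAchievable Λ R})
    ⟨_, 0, rfl, isAchievable_zero Λ⟩ (OrderTop.bddAbove _)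
  choose r hr C hCs hCe using hmem
  obtain ⟨k, hk, hQ⟩ := exists_diagonal (Q := fun k n => Real.exp ((n : ℕ) * r k) ≤ (C k n).size ∧
    (C k n).errorProb (Λ n) ≤ 1 / ((k : ℝ) + 1)) fun k =>
      (eventually_atTop.2 (hCs k)).and ((hCe k).eventually_le_const (u := 1 / ((k : ℝ) + 1)) (by positivity))
  refine ⟨fun n => C (k n) n, ?_, fun R hR => ?_⟩
  · exact squeeze_zero' (Eventually.of_forall fun n => (C (k n) n).errorProb_nonneg _)
      (hQ.mono fun n hn => hn.2)
      ((tendsto_one_div_add_atTop_nhds_zero_nat (𝕜 := ℝ)).comp hk)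
  · filter_upwards [hQ, hk.eventually (hu.eventually_const_lt hR)] with n hn hRn
    rw [hr] at hRn
    have : R < r (k n) := by exact_mod_cast hRn
    refine le_trans ?_ hn.1
    gcongr

theorem capacity_le_infMutualInfoRate {C : ∀ n, Code (κ n) (η n)}
    (hC : Tendsto (fun n => (C n).errorProb (Λ n)) atTop (𝓝 0))
    (hR : ∀ R : ℝ, (R : EReal) < capacity Λ → ∀ᶠ n : ℕ in atTop, Real.exp (n * R) ≤ (C n).size) :
    capacity Λ ≤ infMutualInfoRate
      (fun n => idTensor (Fin (C n).size) (Λ n).lin (C n).cqState) := by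
  refine EReal.ge_of_forall_gt_iff_ge.1 fun γ hγ => ?_
  rw [infMutualInfoRate, infDivergenceRate]
  refine le_sSup ⟨γ, rfl, ?_⟩
  have hst := fun n => (C n).isSeparable_cqState.isState_idTensor (Λ n)
  refine (liminf_eq_one_iff_tendsto fun n => diffTrace_le_one n γ (hst n).1 (hst n).2).2 ?_
  -- The gap between `γ` and `R` makes `e^{nγ} / M_n ≤ e^{n(γ-R)}` vanish.
  obtain ⟨R, hγR, hRc⟩ := EReal.lt_iff_exists_real_btwn.1 hγ
  have hγR : γ < R := by exact_mod_cast hγR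
  have hexp : Tendsto (fun n : ℕ => Real.exp (n * (γ - R))) atTop (𝓝 0) :=
    Real.tendsto_exp_atBot.comp
      ((tendsto_natCast_atTop_atTop).atTop_mul_const_of_neg (sub_neg.2 hγR))
  have hlow : Tendsto (fun n => 1 - (C n).errorProb (Λ n) - Real.exp ((n : ℕ) * (γ - R)))
      atTop (𝓝 1) := by
    simpa using (hC.const_sub 1).sub hexp
  refine tendsto_of_tendsto_of_tendsto_of_le_of_le' hlow tendsto_const_nhds ?_
    (Eventually.of_forall fun n => diffTrace_le_one n γ (hst n).1 (hst n).2)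
  filter_upwards [hR R hRc] with n hn
  refine le_trans ?_ ((C n).le_diffTrace_cqState (Λ n) n γ)
  have : Real.exp (n * γ) / (C n).size ≤ Real.exp (n * (γ - R)) := by
    rw [mul_sub, Real.exp_sub]
    gcongr
  linarith

end Capacity

end QInfoSpectrum

theorem theorem4 {κ η : ℕ → Type*} [∀ n, Fintype (κ n)] [∀ n, DecidableEq (κ n)]
    [∀ n, Nonempty (κ n)] [∀ n, Fintype (η n)] [∀ n, DecidableEq (η n)]
    (Λ : ∀ n, QInfoSpectrum.Channel (κ n) (η n)) :
    IsGreatest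
      {s : EReal | ∃ (d : ℕ → ℕ) (ρ : ∀ n, Matrix (Fin (d n) × κ n) (Fin (d n) × κ n) ℂ),
        (∀ n, QInfoSpectrum.IsSeparable (ρ n)) ∧
          s = QInfoSpectrum.infMutualInfoRate
            (fun n => QInfoSpectrum.idTensor (Fin (d n)) (Λ n).lin (ρ n))}
      (QInfoSpectrum.capacity Λ) := by
  obtain ⟨C, hC, hR⟩ := QInfoSpectrum.exists_codes_capacity Λ
  refine ⟨⟨fun n => (C n).size, fun n => (C n).cqState, fun n => (C n).isSeparable_cqState,
    le_antisymm (QInfoSpectrum.capacity_le_infMutualInfoRate Λ hC hR)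
      (QInfoSpectrum.infMutualInfoRate_le_capacity Λ fun n => (C n).isSeparable_cqState)⟩, ?_⟩
  rintro _ ⟨d, ρ, hρ, rfl⟩
  exact QInfoSpectrum.infMutualInfoRate_le_capacity Λ hρ
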